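/- Write $(z)_k=z(z+1)\cdots(z+k-1)$ and let $$H_4(a,b;c,d;x,y)=\sum_{m=0}^{\infty}\sum_{n=0}^{\infty}\frac{(a)_{2m+n}(b)_n}{(c)_m(d)_n\,m!\,n!}x^my^n$$ be Horn's double hypergeometric series, which converges absolutely for $2\sqrt{|x|}+|y|<1$, and let ${}_2F_1(a,b;c;z)=\sum_{n\ge0}\frac{(a)_n(b)_n}{(c)_n\,n!}z^n$ for $|z|<1$. Let $q_0,q_1\in\mathbb{C}$ be such that neither $1+q_0-q_1$ nor $2q_1$ is an integer $\le 0$. For $s,t\in\mathbb{C}$ with $st\ne1$ put $$x(s,t)=\frac{(s^2-1)(t^2-1)}{4(st-1)^2},\qquad y(s,t)=\frac{2st}{st-1},$$ and let $D\subset\mathbb{C}^2$ be the connected component containing $(1,0)$ of the set of all $(s,t)$ with $st\neq1$, $2\sqrt{|x(s,t)|}+|y(s,t)|<1$, $|1-s^2|<1$ and $|t^2|<1$. Then $D$ is an open neighbourhood of $(1,0)$, and for every $(s,t)\in D$ the double series for $H_4(q_0,q_1;1+q_0-q_1,2q_1;x(s,t),y(s,t))$ converges absolutely and $$H_4\bigl(q_0,q_1;\,1+q_0-q_1,2q_1;\,x(s,t),y(s,t)\bigr)=(1-st)^{q_0}\;{}_2F_1\Bigl(\tfrac{q_0}2+\tfrac12,\tfrac{q_0}2;\,q_0-q_1+1;\,1-s^2\Bigr)\;{}_2F_1\Bigl(\tfrac{q_0}2+\tfrac12,\tfrac{q_0}2;\,q_1+\tfrac12;\,t^2\Bigr),$$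 where $(1-st)^{q_0}$ is the principal power. -/

import Mathlib

/-!
In the sum over `n` of `H₄(a, b; c, 2b; x, y)` one recognizes `₂F₁(a + 2m, b; 2b; y)`, and with
`y = 2z / (z - 1)` a quadratic transformation turns it into a Gauss series in `z²`. Summing over `m`
gives Appell's `F₄` at `((1 - s²)(1 - t²), (st)²)`, where `z = st`. These arguments have the form
`(X (1 - Y), Y (1 - X))` with `X = 1 - s²` and `Y = t²`, and the four parameters `α, β; γ, γ'` of
`F₄` satisfy `γ + γ' = α + β + 1`. In that case `F₄(X (1 - Y), Y (1 - X))`, as a function of `X`,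
is annihilated by the Gauss differential operator, so near `(0, 0)` it is a multiple of
`₂F₁(α, β; γ; X)`, and `X = 0` gives the factor `₂F₁(α, β; γ'; Y)`. The factorization then
propagates along the connected component of `(0, 0)`.
-/

/-- The general term `(a)_{2m+n} (b)_n / ((c)_m (d)_n m! n!) x^m y^n` of Horn's double series `H₄`,
indexed by `k = (m, n)`; here `(a)_k = a (a + 1) ⋯ (a + k - 1)`. -/
noncomputable def hornH4Term (a b c d x y : ℂ) (k : ℕ × ℕ) : ℂ :=
  ((ascPochhammer ℂ (2 * k.1 + k.2)).eval a * (ascPochhammer ℂ k.2).eval b) /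
    ((ascPochhammer ℂ k.1).eval c * (ascPochhammer ℂ k.2).eval d *
      (k.1.factorial : ℂ) * (k.2.factorial : ℂ)) * x ^ k.1 * y ^ k.2

/-- Horn's hypergeometric function `H₄(a, b; c, d; x, y)`, as the sum of its double series. -/
noncomputable def hornH4 (a b c d x y : ℂ) : ℂ :=
  ∑' m : ℕ, ∑' n : ℕ, hornH4Term a b c d x y (m, n)

/-- The first argument `(s² - 1)(t² - 1) / (4 (st - 1)²)`. -/
noncomputable def baileyX (s t : ℂ) : ℂ :=
  (s ^ 2 - 1) * (t ^ 2 - 1) / (4 * (s * t - 1) ^ 2)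

/-- The second argument `2st / (st - 1)`. -/
noncomputable def baileyY (s t : ℂ) : ℂ :=
  2 * s * t / (s * t - 1)

/-- The points `(s, t)` at which the arguments of `H₄` are defined and lie in its domain of
absolute convergence `2 |x|^(1/2) + |y| < 1`, and at which both Gauss series have their arguments
`1 - s²` and `t²` in the open unit disc. -/
def baileyRegion : Set (ℂ × ℂ) :=
  {p | p.1 * p.2 ≠ 1 ∧ 2 * √‖baileyX p.1 p.2‖ + ‖baileyY p.1 p.2‖ < 1 ∧
    ‖1 - p.1 ^ 2‖ < 1 ∧ ‖p.2 ^ 2‖ < 1}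

/-- The connected component of the point `(s, t) = (1, 0)` in `baileyRegion`. -/
def baileyDomain : Set (ℂ × ℂ) :=
  connectedComponentIn baileyRegion (1, 0)

open Filter Topology Metric Set

local notation:max "poch(" a "," n ")" => Polynomial.eval a (ascPochhammer ℂ n)

theorem exists_gt_of_continuousAt_of_lt {α β : Type*} [TopologicalSpace α] [Preorder α]
    [TopologicalSpace β] [LinearOrder β] [OrderTopology β] {f : α → β} {a : α} {c : β}
    [(𝓝[>] a).NeBot] (hf : ContinuousAt f a) (h : f a < c) : ∃ b > a, f b < c := by
  have hlt : ∀ᶠ b in 𝓝[>] a, f b < c := nhdsWithin_le_nhds (hf.eventually_lt_const h)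
  obtain ⟨b, hb, hab⟩ := (hlt.and self_mem_nhdsWithin).exists
  exact ⟨b, hab, hb⟩

/-! ### Rising factorials and the Gauss series -/

theorem ascPochhammer_eval_ne_zero {R : Type*} [Ring R] [IsDomain R] {a : R}
    (ha : ∀ n : ℕ, a ≠ -(n : R)) (n : ℕ) : (ascPochhammer R n).eval a ≠ 0 := fun h => by
  obtain ⟨k, -, hk⟩ := (ascPochhammer_eval_eq_zero_iff n a).1 h
  exact ha k (by rw [hk, neg_neg])

theorem ascPochhammer_eval_add {R : Type*} [CommSemiring R] (a : R) (m n : ℕ) :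
    (ascPochhammer R (m + n)).eval a =
      (ascPochhammer R m).eval a * (ascPochhammer R n).eval (a + m) := by
  rw [← ascPochhammer_mul, Polynomial.eval_mul, Polynomial.eval_comp]
  simp

theorem ascPochhammer_eval_mul_add {R : Type*} [CommSemiring R] (a : R) (n : ℕ) :
    (ascPochhammer R n).eval a * (a + n) = a * (ascPochhammer R n).eval (a + 1) := by
  rw [← ascPochhammer_succ_eval, add_comm n 1, ascPochhammer_eval_add]
  simp

theorem ascPochhammer_eval_two_mul {K : Type*} [Field K] [NeZero (2 : K)] (a : K) (n : ℕ) :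
    (ascPochhammer K (2 * n)).eval a =
      4 ^ n * (ascPochhammer K n).eval (a / 2) * (ascPochhammer K n).eval (a / 2 + 1 / 2) := by
  induction n with
  | zero => simp
  | succ n ih =>
    simp only [mul_add, mul_one, ascPochhammer_succ_eval, ih]
    push_cast
    field_simp
    ring

theorem one_le_radius_ordinaryHypergeometricSeries {𝕂 : Type*} (𝔸 : Type*) [RCLike 𝕂]
    [NormedDivisionRing 𝔸] [NormedAlgebra 𝕂 𝔸] (a b c : 𝕂) :
    1 ≤ (ordinaryHypergeometricSeries 𝔸 a b c).radius := by
  by_cases h : ∀ k : ℕ, (k : 𝕂) ≠ -a ∧ (k : 𝕂) ≠ -b ∧ (k : 𝕂) ≠ -c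
  · exact (ordinaryHypergeometricSeries_radius_eq_one 𝔸 a b c h).ge
  · simp only [not_forall, not_and_or, not_not] at h
    obtain ⟨k, h | h | h⟩ := h <;> rw [eq_neg_iff_add_eq_zero, add_comm, ← eq_neg_iff_add_eq_zero]
      at h <;> subst h
    · simp [ordinaryHypergeometric_radius_top_of_neg_nat₁]
    · simp [ordinaryHypergeometric_radius_top_of_neg_nat₂]
    · simp [ordinaryHypergeometric_radius_top_of_neg_nat₃]

theorem hasFPowerSeriesOnBall_ordinaryHypergeometric {𝕂 : Type*} (𝔸 : Type*) [RCLike 𝕂]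
    [NormedDivisionRing 𝔸] [NormedAlgebra 𝕂 𝔸] [CompleteSpace 𝔸] (a b c : 𝕂) :
    HasFPowerSeriesOnBall (₂F₁ a b c) (ordinaryHypergeometricSeries 𝔸 a b c) 0 1 :=
  have h := one_le_radius_ordinaryHypergeometricSeries 𝔸 a b c
  (FormalMultilinearSeries.hasFPowerSeriesOnBall _ (one_pos.trans_le h)).mono one_pos h

theorem hasSum_ordinaryHypergeometric (a b c : ℂ) {z : ℂ} (hz : ‖z‖ < 1) :
    HasSum (fun n : ℕ => poch(a, n) * poch(b, n) / (poch(c, n) * (n.factorial : ℂ)) * z ^ n)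
      (₂F₁ a b c z) := by
  have h := (hasFPowerSeriesOnBall_ordinaryHypergeometric ℂ a b c).hasSum (y := z)
    (by rwa [mem_eball, edist_zero_right, ← ofReal_norm, ENNReal.ofReal_lt_one])
  rw [zero_add] at h
  refine h.congr_fun fun n => ?_
  rw [ordinaryHypergeometricSeries_apply_eq, smul_eq_mul, div_eq_mul_inv, mul_inv]
  ring

theorem differentiableOn_ordinaryHypergeometric (a b c : ℂ) :
    DifferentiableOn ℂ (₂F₁ a b c) (ball (0 : ℂ) 1) := by
  rw [← eball_ofReal, ENNReal.ofReal_one]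
  exact (hasFPowerSeriesOnBall_ordinaryHypergeometric ℂ a b c).differentiableOn

theorem hasSum_one_sub_cpow_neg (a : ℂ) {z : ℂ} (hz : ‖z‖ < 1) :
    HasSum (fun n : ℕ => poch(a, n) / (n.factorial : ℂ) * z ^ n) ((1 - z) ^ (-a)) := by
  have h := (Complex.one_div_one_sub_cpow_hasFPowerSeriesOnBall_zero a).hasSum (y := z)
    (by rwa [mem_eball, edist_zero_right, ← ofReal_norm, ENNReal.ofReal_lt_one])
  rw [zero_add, one_div, ← Complex.cpow_neg] at h
  refine h.congr_fun fun n => ?_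
  have hch := Ring.factorial_nsmul_multichoose_eq_ascPochhammer a n
  rw [Polynomial.ascPochhammer_smeval_eq_eval, nsmul_eq_mul] at hch
  rw [FormalMultilinearSeries.ofScalars_apply_eq, smul_eq_mul, Ring.choose, ← hch,
    mul_div_cancel_left₀ _ (by exact_mod_cast n.factorial_ne_zero)]
  ring_nf

/-! ### Absolute convergence of the double series -/

theorem exists_norm_ascPochhammer_div_le (a c : ℂ) {θ : ℝ} (hθ : 1 < θ) :
    ∃ C ≥ 0, ∀ n : ℕ, ‖poch(a, n) / poch(c, n)‖ ≤ C * θ ^ n := by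
  have hθ₀ : 0 < θ := one_pos.trans hθ
  have hr : (θ⁻¹.toNNReal : ENNReal) < (ordinaryHypergeometricSeries ℂ a 1 c).radius := by
    refine lt_of_lt_of_le ?_ (one_le_radius_ordinaryHypergeometricSeries ℂ a 1 c)
    exact_mod_cast Real.toNNReal_lt_one.2 (inv_lt_one_of_one_lt₀ hθ)
  obtain ⟨C, hC, hle⟩ := FormalMultilinearSeries.norm_mul_pow_le_of_lt_radius _ hr
  refine ⟨C, hC.le, fun n => ?_⟩
  have hcoeff : ordinaryHypergeometricCoefficient a 1 c n = poch(a, n) / poch(c, n) := by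
    have hn : (n.factorial : ℂ) ≠ 0 := by exact_mod_cast n.factorial_ne_zero
    rw [ordinaryHypergeometricCoefficient, ascPochhammer_eval_one]
    field_simp
  have h := hle n
  rwa [ordinaryHypergeometricSeries, FormalMultilinearSeries.ofScalars_norm, hcoeff,
    Real.coe_toNNReal _ (by positivity), inv_pow, mul_inv_le_iff₀ (by positivity)] at h

theorem summable_choose_mul_pow_mul_pow {u v : ℝ} (hu : 0 ≤ u) (hv : 0 ≤ v) (h : u + v < 1) :
    Summable fun k : ℕ × ℕ => ((k.1 + k.2).choose k.2 : ℝ) * u ^ k.1 * v ^ k.2 := by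
  have hv₁ : 0 < 1 - v := by linarith
  have hrow (m : ℕ) : HasSum (fun n : ℕ => ((m + n).choose n : ℝ) * u ^ m * v ^ n)
      ((1 - v)⁻¹ * (u / (1 - v)) ^ m) := by
    have hs := (hasSum_choose_mul_geometric_of_norm_lt_one m
      (by rw [Real.norm_of_nonneg hv]; linarith : ‖v‖ < 1)).mul_left (u ^ m)
    convert! hs using 1
    · funext n
      rw [add_comm n m, Nat.choose_symm_add]
      ring
    · rw [div_pow]
      field_simp
      ring
  rw [summable_prod_of_nonneg fun k => by positivity]
  refine ⟨fun m => (hrow m).summable, ?_⟩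
  simp_rw [(hrow _).tsum_eq]
  refine (summable_geometric_of_lt_one (by positivity) ?_).mul_left _
  rw [div_lt_one hv₁]
  linarith

theorem factorial_two_mul_add_le (m n : ℕ) :
    ((2 * m + n).factorial : ℝ) / (m.factorial * m.factorial * n.factorial) ≤
      (2 * m + n).choose n * 4 ^ m := by
  have h₁ : ((2 * m + n).factorial : ℝ) =
      (2 * m + n).choose n * (2 * m).factorial * n.factorial := by
    exact_mod_cast (Nat.add_choose_mul_factorial_mul_factorial (2 * m) n).symm
  have h₂ : ((2 * m).factorial : ℝ) = m.centralBinom * m.factorial * m.factorial := by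
    rw [Nat.centralBinom, two_mul]
    exact_mod_cast (Nat.add_choose_mul_factorial_mul_factorial m m).symm
  have h₃ : (m.centralBinom : ℝ) ≤ 4 ^ m := by exact_mod_cast Nat.centralBinom_le_four_pow m
  calc _ = ((2 * m + n).choose n : ℝ) * m.centralBinom := by rw [h₁, h₂]; field_simp
    _ ≤ _ := by gcongr

theorem hornH4Term_eq (a b c d x y : ℂ) (m n : ℕ) :
    hornH4Term a b c d x y (m, n) =
      poch(a, 2 * m + n) / poch(1, 2 * m + n) * (poch(b, n) / poch(d, n)) *
        (poch(1, m) / poch(c, m)) *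
        ((2 * m + n).factorial / (m.factorial * m.factorial * n.factorial)) * x ^ m * y ^ n := by
  have h (k : ℕ) : (k.factorial : ℂ) ≠ 0 := by exact_mod_cast k.factorial_ne_zero
  have h₁ := h m
  have h₂ := h (2 * m + n)
  simp only [hornH4Term, ascPochhammer_eval_one]
  simp only [div_eq_mul_inv, mul_inv]
  field_simp

theorem summable_hornH4Term (a b c d : ℂ) {x y : ℂ} (h : 2 * √‖x‖ + ‖y‖ < 1) :
    Summable (hornH4Term a b c d x y) := by
  obtain ⟨θ, hθ, hlt⟩ : ∃ θ > 1, 2 * √(θ ^ 3 * ‖x‖) + θ ^ 2 * ‖y‖ < 1 :=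
    exists_gt_of_continuousAt_of_lt (by fun_prop) (by simpa using h)
  have hθ₀ : 0 < θ := one_pos.trans hθ
  obtain ⟨A, hA, ha⟩ := exists_norm_ascPochhammer_div_le a 1 hθ
  obtain ⟨B, hB, hb⟩ := exists_norm_ascPochhammer_div_le b d hθ
  obtain ⟨C, hC, hc⟩ := exists_norm_ascPochhammer_div_le 1 c hθ
  have hinj : Function.Injective fun k : ℕ × ℕ => (2 * k.1, k.2) := fun k l hkl => by
    simp only [Prod.mk.injEq] at hkl
    exact Prod.ext (by omega) hkl.2
  have hdom := ((summable_choose_mul_pow_mul_pow (by positivity) (by positivity)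
    hlt).comp_injective hinj).mul_left (A * B * C)
  refine hdom.of_norm_bounded fun ⟨m, n⟩ => ?_
  simp only [hornH4Term_eq, norm_mul, norm_pow, Function.comp_apply]
  calc _ ≤ A * θ ^ (2 * m + n) * (B * θ ^ n) * (C * θ ^ m) * ((2 * m + n).choose n * 4 ^ m) *
        ‖x‖ ^ m * ‖y‖ ^ n := by
        gcongr
        · exact ha _
        · exact hb n
        · exact hc m
        · simpa using factorial_two_mul_add_le m n
    _ = _ := by
        rw [pow_mul (2 * _), mul_pow 2, Real.sq_sqrt (by positivity),
          show (2 : ℝ) ^ 2 = 4 by norm_num]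
        simp only [pow_add, mul_pow, ← pow_mul]
        ring

/-! ### The quadratic transformation -/

section BetaFunctional

open Polynomial

/-- The linear functional `Xⁿ ↦ (a)ₙ / (c)ₙ` on polynomials. For `0 < a < c` it is the expectation
under the beta distribution with parameters `a` and `c - a`, so it turns Euler's integral for the
Gauss series into algebra. -/
noncomputable def betaFunctional (a c : ℂ) : ℂ[X] →ₗ[ℂ] ℂ :=
  Polynomial.lsum fun n => LinearMap.mulRight ℂ (poch(a, n) / poch(c, n))

theorem betaFunctional_X_pow (a c : ℂ) (n : ℕ) :
    betaFunctional a c (X ^ n) = poch(a, n) / poch(c, n) := by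
  simp [betaFunctional, Polynomial.lsum_apply, ← Polynomial.monomial_one_right_eq_X_pow]

-- Stein's identity: integration by parts against the density `x ^ (a - 1) (1 - x) ^ (c - a - 1)`.
theorem betaFunctional_mul_sub (a : ℂ) {c : ℂ} (hc : ∀ n : ℕ, c ≠ -(n : ℂ)) (p : ℂ[X]) :
    betaFunctional a c ((C c * X - C a) * p) =
      betaFunctional a c (X * (1 - X) * derivative p) := by
  induction p using Polynomial.induction_on' with
  | add p q hp hq => rw [mul_add, map_add, hp, hq, derivative_add, mul_add, map_add]
  | monomial n r =>
    have hmoment : (c + n) * (poch(a, n + 1) / poch(c, n + 1)) =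
        (a + n) * (poch(a, n) / poch(c, n)) := by
      have h₁ : c + n ≠ 0 := fun h => hc n (eq_neg_of_add_eq_zero_left h)
      have h₂ := ascPochhammer_eval_ne_zero hc n
      simp only [ascPochhammer_succ_eval]
      field_simp
    have hleft : (C c * X - C a) * monomial n r = (r * c) • X ^ (n + 1) - (r * a) • X ^ n := by
      simp only [← C_mul_X_pow_eq_monomial, smul_eq_C_mul, map_mul]
      ring
    have hright : X * (1 - X) * derivative (monomial n r) =
        (r * n) • X ^ n - (r * n) • (X : ℂ[X]) ^ (n + 1) := by
      cases n with
      | zero => simp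
      | succ n =>
        rw [derivative_monomial, Nat.add_sub_cancel]
        simp only [← C_mul_X_pow_eq_monomial, smul_eq_C_mul, map_mul]
        ring
    rw [hleft, hright]
    simp only [map_sub, map_smul, betaFunctional_X_pow, smul_eq_mul]
    linear_combination r * hmoment

theorem betaFunctional_one_sub_C_mul_X_pow (a c w : ℂ) (N : ℕ) :
    betaFunctional a c ((1 - C w * X) ^ N) = ∑ k ∈ Finset.HasAntidiagonal.antidiagonal N,
      N.choose k.1 * ((-w) ^ k.1 * (poch(a, k.1) / poch(c, k.1))) := by
  have h : (1 - C w * X : ℂ[X]) = (-w) • X + 1 := by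
    rw [smul_eq_C_mul, map_neg]
    ring
  rw [h, (Commute.one_right ((-w) • X : ℂ[X])).add_pow']
  simp only [one_pow, mul_one, _root_.smul_pow, map_sum, map_nsmul, map_smul,
    betaFunctional_X_pow]
  simp only [nsmul_eq_mul, smul_eq_mul]

theorem betaFunctional_symmetric_rec {b : ℂ} (hb : ∀ n : ℕ, 2 * b ≠ -(n : ℂ)) (N : ℕ) :
    (2 * b + N + 1) * betaFunctional b (2 * b) ((1 - C 2 * X) ^ (N + 2)) =
      (N + 1) * betaFunctional b (2 * b) ((1 - C 2 * X) ^ N) := by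
  have hstein := betaFunctional_mul_sub b hb ((1 - C 2 * X) ^ (N + 1))
  have hleft : (C (2 * b) * X - C b) * (1 - C 2 * X) ^ (N + 1) =
      (-b) • (1 - C 2 * X : ℂ[X]) ^ (N + 2) := by
    simp only [smul_eq_C_mul, map_neg, map_mul]
    ring
  have hright : X * (1 - X) * derivative ((1 - C 2 * X) ^ (N + 1)) =
      ((N + 1) / 2 : ℂ) • (1 - C 2 * X : ℂ[X]) ^ (N + 2) -
        ((N + 1) / 2 : ℂ) • (1 - C 2 * X) ^ N := by
    have h : (C ((N + 1) / 2 : ℂ) : ℂ[X]) * 2 = N + 1 := by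
      rw [← C_ofNat, ← C_mul, div_mul_cancel₀ _ two_ne_zero]
      simp
    simp only [smul_eq_C_mul, derivative_pow_succ, map_sub, derivative_one, derivative_mul,
      derivative_C, derivative_X, map_add, map_natCast, C_1]
    rw [C_ofNat]
    linear_combination (2 * X * (1 - X) * (1 - 2 * X) ^ N : ℂ[X]) * h
  rw [hleft, hright] at hstein
  simp only [map_sub, map_smul, smul_eq_mul] at hstein
  linear_combination -2 * hstein

theorem betaFunctional_symmetric_odd {b : ℂ} (hb : ∀ n : ℕ, 2 * b ≠ -(n : ℂ)) (j : ℕ) :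
    betaFunctional b (2 * b) ((1 - C 2 * X) ^ (2 * j + 1)) = 0 := by
  induction j with
  | zero =>
    have hb₀ : b ≠ 0 := fun h => hb 0 (by simp [h])
    have hleft : (C (2 * b) * X - C b) * 1 = (-b) • (1 - C 2 * X : ℂ[X]) := by
      simp only [smul_eq_C_mul, map_neg, map_mul]
      ring
    have hstein := betaFunctional_mul_sub b hb 1
    rw [hleft, derivative_one, mul_zero, map_zero, map_smul, smul_eq_mul] at hstein
    simpa using (mul_eq_zero.1 hstein).resolve_left (neg_ne_zero.2 hb₀)
  | succ j ih =>
    have hrec := betaFunctional_symmetric_rec hb (2 * j + 1)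
    rw [ih, mul_zero] at hrec
    refine (mul_eq_zero.1 hrec).resolve_left fun h => hb (2 * j + 2) ?_
    push_cast at h ⊢
    linear_combination h

theorem add_half_ne_neg_natCast {b : ℂ} (hb : ∀ n : ℕ, 2 * b ≠ -(n : ℂ)) (n : ℕ) :
    b + 1 / 2 ≠ -(n : ℂ) :=
  fun h => hb (2 * n + 1) (by push_cast; linear_combination 2 * h)

theorem betaFunctional_symmetric_even {b : ℂ} (hb : ∀ n : ℕ, 2 * b ≠ -(n : ℂ)) (j : ℕ) :
    betaFunctional b (2 * b) ((1 - C 2 * X) ^ (2 * j)) = poch(1 / 2, j) / poch(b + 1 / 2, j) := by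
  induction j with
  | zero => simpa using betaFunctional_X_pow b (2 * b) 0
  | succ j ih =>
    have hrec := betaFunctional_symmetric_rec hb (2 * j)
    have h₁ : b + 1 / 2 + j ≠ 0 := fun h =>
      add_half_ne_neg_natCast hb j (eq_neg_of_add_eq_zero_left h)
    have h₂ := ascPochhammer_eval_ne_zero (add_half_ne_neg_natCast hb) j
    rw [ih, mul_div_assoc', eq_div_iff h₂] at hrec
    rw [ascPochhammer_succ_eval, ascPochhammer_succ_eval, eq_div_iff (mul_ne_zero h₂ h₁)]
    push_cast at hrec
    linear_combination hrec / 2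

theorem summable_ascPochhammer_transformation (a b c : ℂ) {w z : ℂ} (hz : (‖w‖ + 1) * ‖z‖ < 1) :
    Summable fun k : ℕ × ℕ => poch(b, k.1) / poch(c, k.1) *
      (poch(a, k.1 + k.2) / (k.1.factorial * k.2.factorial)) * (-w * z) ^ k.1 * z ^ k.2 := by
  obtain ⟨θ, hθ, hlt⟩ : ∃ θ > 1, θ ^ 2 * (‖w‖ * ‖z‖) + θ * ‖z‖ < 1 :=
    exists_gt_of_continuousAt_of_lt (by fun_prop) (by linarith)
  have hθ₀ : 0 < θ := one_pos.trans hθ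
  obtain ⟨A, -, ha⟩ := exists_norm_ascPochhammer_div_le a 1 hθ
  obtain ⟨B, hB, hb⟩ := exists_norm_ascPochhammer_div_le b c hθ
  refine ((summable_choose_mul_pow_mul_pow (by positivity) (by positivity) hlt).mul_left
    (A * B)).of_norm_bounded fun ⟨m, n⟩ => ?_
  have hchoose : poch(a, m + n) / (m.factorial * n.factorial) =
      poch(a, m + n) / poch(1, m + n) * ((m + n).choose n : ℂ) := by
    have h (k : ℕ) : (k.factorial : ℂ) ≠ 0 := by exact_mod_cast k.factorial_ne_zero
    rw [ascPochhammer_eval_one, ← Nat.choose_symm_add, Nat.cast_add_choose, mul_div_assoc',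
      div_mul_cancel₀ _ (h _)]
  simp only [hchoose, norm_mul, norm_pow, norm_neg, Complex.norm_natCast]
  calc _ ≤ B * θ ^ m * (A * θ ^ (m + n) * (m + n).choose n) * (‖w‖ * ‖z‖) ^ m * ‖z‖ ^ n := by
        gcongr
        · exact hb m
        · exact ha _
    _ = _ := by ring

-- Expand `(1 - z + w z X) ^ (-a) = (1 - z (1 - w X)) ^ (-a)` in powers of `w z X / (1 - z)` and in
-- powers of `z`, and apply the functional to both expansions.
theorem hasSum_betaFunctional_one_sub_C_mul_X_pow (a b c : ℂ) {w z : ℂ}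
    (hz : (‖w‖ + 1) * ‖z‖ < 1) :
    HasSum (fun N : ℕ => poch(a, N) / (N.factorial : ℂ) *
        betaFunctional b c ((1 - C w * X) ^ N) * z ^ N)
      ((1 - z) ^ (-a) * ₂F₁ a b c (w * z / (z - 1))) := by
  set F : ℕ × ℕ → ℂ := fun k => poch(b, k.1) / poch(c, k.1) *
    (poch(a, k.1 + k.2) / (k.1.factorial * k.2.factorial)) * (-w * z) ^ k.1 * z ^ k.2 with hF
  have hF_sum := summable_ascPochhammer_transformation a b c hz
  have hwz : 0 ≤ ‖w‖ * ‖z‖ := by positivity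
  have hz₁ : ‖z‖ < 1 := by linarith
  have hz₀ : 1 - z ≠ 0 := sub_ne_zero.2 fun h => by simp [← h] at hz₁
  have hz₂ : ‖w * z / (z - 1)‖ < 1 := by
    have h := norm_sub_norm_le 1 z
    rw [norm_one, norm_sub_rev] at h
    rw [norm_div, norm_mul, div_lt_one (by linarith)]
    linarith
  have hrows : ∑' k, F k = (1 - z) ^ (-a) * ₂F₁ a b c (w * z / (z - 1)) := by
    refine (hF_sum.hasSum.prod_fiberwise fun n => ?_).unique
      ((hasSum_ordinaryHypergeometric a b c hz₂).mul_left _)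
    convert! (hasSum_one_sub_cpow_neg (a + n) hz₁).mul_left
      (poch(b, n) / poch(c, n) * (poch(a, n) / n.factorial) * (-w * z) ^ n) using 1
    · funext k
      simp only [ascPochhammer_eval_add, div_eq_mul_inv, mul_inv]
      ring
    · rw [neg_add, Complex.cpow_add _ _ hz₀, Complex.cpow_neg _ (n : ℂ), Complex.cpow_natCast,
        show w * z / (z - 1) = -w * z * (1 - z)⁻¹ by rw [← neg_sub 1 z, div_neg]; ring, mul_pow]
      simp only [div_eq_mul_inv, mul_inv, inv_pow]
      ring
  rw [← hrows]
  let e := Finset.HasAntidiagonal.sigmaAntidiagonalEquivProd (A := ℕ)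
  refine (e.hasSum_iff.2 hF_sum.hasSum).sigma fun N => ?_
  convert! (Finset.HasAntidiagonal.antidiagonal N).hasSum F using 1
  rw [betaFunctional_one_sub_C_mul_X_pow, Finset.mul_sum, Finset.sum_mul]
  refine Finset.sum_congr rfl fun k hk => ?_
  have hN : (N.factorial : ℂ) ≠ 0 := by exact_mod_cast N.factorial_ne_zero
  obtain rfl := Finset.HasAntidiagonal.mem_antidiagonal.1 hk
  rw [Nat.cast_add_choose, pow_add]
  simp only [hF, mul_pow]
  field_simp

theorem ordinaryHypergeometric_quadratic_of_norm_lt (a : ℂ) {b : ℂ}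
    (hb : ∀ n : ℕ, 2 * b ≠ -(n : ℂ)) {z : ℂ} (hz : ‖z‖ < 1 / 3) :
    (1 - z) ^ (-a) * ₂F₁ a b (2 * b) (2 * z / (z - 1)) =
      ₂F₁ (a / 2 + 1 / 2) (a / 2) (b + 1 / 2) (z ^ 2) := by
  have hz₂ : (‖(2 : ℂ)‖ + 1) * ‖z‖ < 1 := by
    rw [Complex.norm_ofNat]
    linarith
  have hsq : ‖z ^ 2‖ < 1 := by
    rw [norm_pow]
    exact pow_lt_one₀ (norm_nonneg z) (by linarith) two_ne_zero
  refine (hasSum_betaFunctional_one_sub_C_mul_X_pow a b (2 * b) hz₂).unique ?_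
  rw [← add_zero (₂F₁ _ _ _ _)]
  refine HasSum.even_add_odd ?_ ?_
  · convert! hasSum_ordinaryHypergeometric (a / 2 + 1 / 2) (a / 2) (b + 1 / 2) hsq using 1
    funext j
    have hhalf : poch(1 / 2, j) ≠ 0 := ascPochhammer_eval_ne_zero (fun n h => by
      have : (1 / 2 : ℝ) = -n := by simpa using congrArg Complex.re h
      linarith [n.cast_nonneg (α := ℝ)]) j
    have hfact : ((2 * j).factorial : ℂ) = 4 ^ j * poch(1 / 2, j) * j.factorial := by
      rw [← ascPochhammer_eval_one, ← ascPochhammer_eval_one, ascPochhammer_eval_two_mul]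
      norm_num
    rw [betaFunctional_symmetric_even hb, ascPochhammer_eval_two_mul a, hfact, pow_mul]
    field_simp
  · simp only [betaFunctional_symmetric_odd hb, mul_zero, zero_mul]
    exact hasSum_zero

end BetaFunctional

theorem norm_lt_one_of_two_mul_norm_lt {z : ℂ} (hz : 2 * ‖z‖ < ‖1 - z‖) : ‖z‖ < 1 := by
  have h := norm_sub_le 1 z
  rw [norm_one] at h
  linarith

theorem setOf_two_mul_norm_lt_eq_ball :
    {z : ℂ | 2 * ‖z‖ < ‖1 - z‖} = ball (-1 / 3) (2 / 3) := by
  ext z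
  rw [mem_ofPred_eq, mem_ball, Complex.dist_eq, ← sq_lt_sq₀ (by positivity) (norm_nonneg _),
    ← sq_lt_sq₀ (norm_nonneg _) (by norm_num), mul_pow, Complex.sq_norm, Complex.sq_norm,
    Complex.sq_norm, Complex.normSq_apply, Complex.normSq_apply, Complex.normSq_apply]
  norm_num
  constructor <;> intro h <;> nlinarith

theorem ordinaryHypergeometric_quadratic (a : ℂ) {b : ℂ} (hb : ∀ n : ℕ, 2 * b ≠ -(n : ℂ)) {z : ℂ}
    (hz : 2 * ‖z‖ < ‖1 - z‖) :
    ₂F₁ a b (2 * b) (2 * z / (z - 1)) =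
      (1 - z) ^ a * ₂F₁ (a / 2 + 1 / 2) (a / 2) (b + 1 / 2) (z ^ 2) := by
  set U : Set ℂ := {z | 2 * ‖z‖ < ‖1 - z‖} with hU
  have hUo : IsOpen U := isOpen_lt (by fun_prop) (by fun_prop)
  have hUc : IsPreconnected U := by
    rw [hU, setOf_two_mul_norm_lt_eq_ball]
    exact (convex_ball _ _).isPreconnected
  have hne {z : ℂ} (hz : z ∈ U) : z - 1 ≠ 0 := sub_ne_zero.2 fun h => by
    simpa [h] using norm_lt_one_of_two_mul_norm_lt hz
  have hsq {z : ℂ} (hz : z ∈ U) : z ^ 2 ∈ ball (0 : ℂ) 1 := by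
    rw [mem_ball_zero_iff, norm_pow]
    exact pow_lt_one₀ (norm_nonneg z) (norm_lt_one_of_two_mul_norm_lt hz) two_ne_zero
  have hleft : DifferentiableOn ℂ (fun z => ₂F₁ a b (2 * b) (2 * z / (z - 1))) U := by
    refine (differentiableOn_ordinaryHypergeometric a b (2 * b)).comp
      (DifferentiableOn.div (by fun_prop) (by fun_prop) fun z => hne) fun z hz => ?_
    rwa [mem_ball_zero_iff, norm_div, norm_mul, Complex.norm_ofNat,
      div_lt_one (norm_pos_iff.2 (hne hz)), norm_sub_rev]
  have hright : DifferentiableOn ℂ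
      (fun z => (1 - z) ^ a * ₂F₁ (a / 2 + 1 / 2) (a / 2) (b + 1 / 2) (z ^ 2)) U := by
    refine DifferentiableOn.mul (DifferentiableOn.cpow_const (by fun_prop) fun z hz => Or.inl ?_)
      ((differentiableOn_ordinaryHypergeometric _ _ _).comp (by fun_prop) fun z => hsq)
    have := (Complex.re_le_norm z).trans_lt (norm_lt_one_of_two_mul_norm_lt hz)
    simpa using this
  refine (hleft.analyticOnNhd hUo).eqOn_of_preconnected_of_eventuallyEq (hright.analyticOnNhd hUo)
    hUc (show (0 : ℂ) ∈ U by simp [hU]) ?_ hz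
  filter_upwards [ball_mem_nhds (0 : ℂ) (show (0 : ℝ) < 1 / 3 by norm_num), hUo.mem_nhds
    (show (0 : ℂ) ∈ U by simp [hU])] with z hz₁ hz₂
  have hz₀ : 1 - z ≠ 0 := fun h => hne hz₂ (by linear_combination -h)
  rw [← ordinaryHypergeometric_quadratic_of_norm_lt a hb (mem_ball_zero_iff.1 hz₁), ← mul_assoc,
    ← Complex.cpow_add _ _ hz₀, add_neg_cancel, Complex.cpow_zero, one_mul]

/-! ### Appell's series `F₄` -/

/-- The coefficient `(α)ₘ₊ₙ (β)ₘ₊ₙ / ((γ)ₘ (γ')ₙ m! n!)` of Appell's double series `F₄`, indexed by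
`k = (m, n)`. -/
noncomputable def appellF4Coeff (α β γ γ' : ℂ) (k : ℕ × ℕ) : ℂ :=
  poch(α, k.1 + k.2) * poch(β, k.1 + k.2) /
    (poch(γ, k.1) * poch(γ', k.2) * (k.1.factorial : ℂ) * (k.2.factorial : ℂ))

/-- Appell's function `F₄(α, β; γ, γ'; x, y)`, as the sum of its double series. -/
noncomputable def appellF4 (α β γ γ' x y : ℂ) : ℂ :=
  ∑' k, appellF4Coeff α β γ γ' k * x ^ k.1 * y ^ k.2

theorem summable_sq_choose_mul_pow_mul_pow {u v : ℝ} (hu : 0 ≤ u) (hv : 0 ≤ v) (h : u + v < 1) :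
    Summable fun k : ℕ × ℕ => (((k.1 + k.2).choose k.2 : ℝ) * u ^ k.1 * v ^ k.2) ^ 2 := by
  have hs := summable_choose_mul_pow_mul_pow hu hv h
  refine .of_nonneg_of_le (fun k => sq_nonneg _) (fun k => ?_) (hs.mul_left
    (∑' k : ℕ × ℕ, ((k.1 + k.2).choose k.2 : ℝ) * u ^ k.1 * v ^ k.2))
  rw [sq]
  exact mul_le_mul_of_nonneg_right (hs.le_tsum k fun k _ => by positivity) (by positivity)

theorem appellF4Coeff_eq (α β γ γ' : ℂ) (m n : ℕ) :
    appellF4Coeff α β γ γ' (m, n) =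
      poch(α, m + n) / poch(1, m + n) * (poch(β, m + n) / poch(1, m + n)) *
        (poch(1, m) / poch(γ, m)) * (poch(1, n) / poch(γ', n)) * ((m + n).choose n : ℂ) ^ 2 := by
  have h (k : ℕ) : (k.factorial : ℂ) ≠ 0 := by exact_mod_cast k.factorial_ne_zero
  have hm := h m
  have hn := h n
  have hmn := h (m + n)
  rw [appellF4Coeff, ← Nat.choose_symm_add, Nat.cast_add_choose]
  simp only [ascPochhammer_eval_one]
  simp only [div_eq_mul_inv, mul_inv]
  field_simp

theorem summable_appellF4 (α β γ γ' : ℂ) {x y : ℂ} (h : √‖x‖ + √‖y‖ < 1) :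
    Summable fun k => appellF4Coeff α β γ γ' k * x ^ k.1 * y ^ k.2 := by
  obtain ⟨θ, hθ, hlt⟩ : ∃ θ > 1, √(θ ^ 3 * ‖x‖) + √(θ ^ 3 * ‖y‖) < 1 :=
    exists_gt_of_continuousAt_of_lt (by fun_prop) (by simpa using h)
  have hθ₀ : 0 < θ := one_pos.trans hθ
  obtain ⟨A, hA, hα⟩ := exists_norm_ascPochhammer_div_le α 1 hθ
  obtain ⟨B, hB, hβ⟩ := exists_norm_ascPochhammer_div_le β 1 hθ
  obtain ⟨C, hC, hγ⟩ := exists_norm_ascPochhammer_div_le 1 γ hθ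
  obtain ⟨D, -, hγ'⟩ := exists_norm_ascPochhammer_div_le 1 γ' hθ
  have hdom := (summable_sq_choose_mul_pow_mul_pow (by positivity) (by positivity) hlt).mul_left
    (A * B * C * D)
  refine hdom.of_norm_bounded fun ⟨m, n⟩ => ?_
  simp only [appellF4Coeff_eq, norm_mul, norm_pow, Complex.norm_natCast]
  calc _ ≤ A * θ ^ (m + n) * (B * θ ^ (m + n)) * (C * θ ^ m) * (D * θ ^ n) *
        ((m + n).choose n : ℝ) ^ 2 * ‖x‖ ^ m * ‖y‖ ^ n := by
        gcongr
        · exact hα _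
        · exact hβ _
        · exact hγ m
        · exact hγ' n
    _ = _ := by
        simp only [mul_pow, pow_right_comm _ _ 2]
        rw [Real.sq_sqrt (by positivity), Real.sq_sqrt (by positivity)]
        ring

theorem hasSumLocallyUniformlyOn_appellF4 {E : Type*} [TopologicalSpace E] (α β γ γ' : ℂ)
    {x y : E → ℂ} {V : Set E} (hx : ContinuousOn x V) (hy : ContinuousOn y V)
    (hlt : ∀ w ∈ V, √‖x w‖ + √‖y w‖ < 1) :
    HasSumLocallyUniformlyOn (fun k w => appellF4Coeff α β γ γ' k * x w ^ k.1 * y w ^ k.2)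
      (fun w => appellF4 α β γ γ' (x w) (y w)) V := by
  refine hasSumLocallyUniformlyOn_of_of_forall_exists_nhds fun w₀ hw₀ => ?_
  obtain ⟨δ, hδ, hlt⟩ : ∃ δ > 0, √(‖x w₀‖ + δ) + √(‖y w₀‖ + δ) < 1 :=
    exists_gt_of_continuousAt_of_lt (by fun_prop) (by simpa using hlt w₀ hw₀)
  have hr : 0 ≤ ‖x w₀‖ + δ := by positivity
  have hρ : 0 ≤ ‖y w₀‖ + δ := by positivity
  have hdom := (summable_appellF4 α β γ γ' (x := (‖x w₀‖ + δ : ℝ)) (y := (‖y w₀‖ + δ : ℝ))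
    (by rwa [Complex.norm_of_nonneg hr, Complex.norm_of_nonneg hρ])).norm
  refine ⟨{w | ‖x w‖ < ‖x w₀‖ + δ ∧ ‖y w‖ < ‖y w₀‖ + δ},
    ((hx w₀ hw₀).norm.eventually_lt_const (by linarith)).and
      ((hy w₀ hw₀).norm.eventually_lt_const (by linarith)),
    HasSumUniformlyOn.of_norm_le_summable hdom fun k w hw => ?_⟩
  simp only [norm_mul, norm_pow, Complex.norm_of_nonneg hr, Complex.norm_of_nonneg hρ]
  gcongr
  · exact hw.1.le
  · exact hw.2.le

theorem differentiableOn_appellF4 (α β γ γ' : ℂ) {x y : ℂ → ℂ} {V : Set ℂ} (hV : IsOpen V)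
    (hx : DifferentiableOn ℂ x V) (hy : DifferentiableOn ℂ y V)
    (hlt : ∀ w ∈ V, √‖x w‖ + √‖y w‖ < 1) :
    DifferentiableOn ℂ (fun w => appellF4 α β γ γ' (x w) (y w)) V :=
  (hasSumLocallyUniformlyOn_appellF4 α β γ γ' hx.continuousOn hy.continuousOn
    hlt).differentiableOn (Eventually.of_forall fun _ => DifferentiableOn.fun_sum fun k _ =>
      ((hx.pow k.1).const_mul _).mul (hy.pow k.2)) hV

theorem appellF4_zero_left (α β γ γ' : ℂ) {y : ℂ} (hy : ‖y‖ < 1) :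
    appellF4 α β γ γ' 0 y = ₂F₁ α β γ' y := by
  have hinj : Function.Injective fun n : ℕ => ((0, n) : ℕ × ℕ) := fun m n h => by simpa using h
  refine (hinj.hasSum_iff fun k hk => ?_).1 ?_ |>.tsum_eq
  · have : k.1 ≠ 0 := fun h => hk ⟨k.2, Prod.ext h.symm rfl⟩
    simp [this]
  · refine (hasSum_ordinaryHypergeometric α β γ' hy).congr_fun fun n => ?_
    simp [appellF4Coeff]

/-! ### The Gauss differential equation -/

/-- The hypergeometric differential operator `z (1 - z) f'' + (γ - (α + β + 1) z) f' - α β f`; the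
Gauss series `₂F₁ α β γ` is its holomorphic solution at `0`. -/
noncomputable def hypergeometricOperator (α β γ : ℂ) (f : ℂ → ℂ) (z : ℂ) : ℂ :=
  z * (1 - z) * deriv (deriv f) z + (γ - (α + β + 1) * z) * deriv f z - α * β * f z

theorem hasSumLocallyUniformlyOn_deriv {ι E : Type*} [NormedAddCommGroup E] [NormedSpace ℂ E]
    [CompleteSpace E] {f : ι → ℂ → E} {g : ℂ → E} {U : Set ℂ}
    (h : HasSumLocallyUniformlyOn f g U) (hf : ∀ i, DifferentiableOn ℂ (f i) U) (hU : IsOpen U) :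
    HasSumLocallyUniformlyOn (fun i => deriv (f i)) (deriv g) U := by
  refine (TendstoLocallyUniformlyOn.deriv h (Eventually.of_forall fun s =>
    DifferentiableOn.fun_sum fun i _ => hf i) hU).congr fun s z hz => ?_
  exact deriv_fun_sum fun i _ => (hf i).differentiableAt (hU.mem_nhds hz)

theorem hasSum_hypergeometricOperator {ι : Type*} (α β γ : ℂ) {f : ι → ℂ → ℂ} {g : ℂ → ℂ}
    {U : Set ℂ} (h : HasSumLocallyUniformlyOn f g U) (hf : ∀ i, DifferentiableOn ℂ (f i) U)
    (hU : IsOpen U) {z : ℂ} (hz : z ∈ U) :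
    HasSum (fun i => hypergeometricOperator α β γ (f i) z) (hypergeometricOperator α β γ g z) := by
  have h₁ := hasSumLocallyUniformlyOn_deriv h hf hU
  have h₂ := hasSumLocallyUniformlyOn_deriv h₁ (fun i => (hf i).deriv hU) hU
  exact (((h₂.hasSum hz).mul_left _).add ((h₁.hasSum hz).mul_left _)).sub
    ((h.hasSum hz).mul_left _)

theorem hypergeometricOperator_const_mul (α β γ c : ℂ) (f : ℂ → ℂ) (z : ℂ) :
    hypergeometricOperator α β γ (fun z => c * f z) z = c * hypergeometricOperator α β γ f z := by
  have hderiv (g : ℂ → ℂ) : (deriv fun z => c * g z) = fun z => c * deriv g z :=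
    funext fun z => deriv_const_mul_field c
  simp only [hypergeometricOperator, hderiv]
  ring

theorem iteratedDeriv_id_mul_zero {𝕜 : Type*} [NontriviallyNormedField 𝕜] {n : ℕ} {h : 𝕜 → 𝕜}
    (hh : ContDiffAt 𝕜 n h 0) :
    iteratedDeriv n (fun z => z * h z) 0 = n * iteratedDeriv (n - 1) h 0 := by
  rw [iteratedDeriv_fun_mul contDiffAt_fun_id hh]
  simp only [iteratedDeriv_fun_id_zero]
  cases n with
  | zero => simp
  | succ n =>
    rw [Finset.sum_eq_single 1]
    · simp
    · intro i _ hi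
      simp [hi]
    · simp

theorem iteratedDeriv_succ_of_hypergeometricOperator_eq_zero {α β γ : ℂ} {f : ℂ → ℂ}
    (hf : AnalyticAt ℂ f 0) (hode : hypergeometricOperator α β γ f =ᶠ[𝓝 0] 0) (n : ℕ) :
    (γ + n) * iteratedDeriv (n + 1) f 0 = (α + n) * (β + n) * iteratedDeriv n f 0 := by
  have hf' : AnalyticAt ℂ (deriv f) 0 := hf.deriv
  have hf'' : AnalyticAt ℂ (deriv (deriv f)) 0 := hf'.deriv
  have hzf' : AnalyticAt ℂ (fun z => z * deriv f z) 0 := analyticAt_id.mul hf'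
  have hzf'' : AnalyticAt ℂ (fun z => z * deriv (deriv f) z) 0 := analyticAt_id.mul hf''
  have hzzf'' : AnalyticAt ℂ (fun z => z * (z * deriv (deriv f) z)) 0 := analyticAt_id.mul hzf''
  have heq : (fun z => z * deriv (deriv f) z + γ * deriv f z) =ᶠ[𝓝 0] fun z =>
      z * (z * deriv (deriv f) z) + ((α + β + 1) * (z * deriv f z) + α * β * f z) := by
    filter_upwards [hode] with z hz
    rw [hypergeometricOperator, Pi.zero_apply] at hz
    linear_combination hz
  have hγ : AnalyticAt ℂ (fun z => γ * deriv f z) 0 := analyticAt_const.mul hf'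
  have h₁ : AnalyticAt ℂ (fun z => (α + β + 1) * (z * deriv f z)) 0 := analyticAt_const.mul hzf'
  have h₀ : AnalyticAt ℂ (fun z => α * β * f z) 0 := analyticAt_const.mul hf
  have hn := heq.iteratedDeriv_eq n
  rw [iteratedDeriv_fun_add hzf''.contDiffAt hγ.contDiffAt,
    iteratedDeriv_fun_add hzzf''.contDiffAt (h₁.fun_add h₀).contDiffAt,
    iteratedDeriv_fun_add h₁.contDiffAt h₀.contDiffAt] at hn
  simp only [iteratedDeriv_const_mul_field, iteratedDeriv_id_mul_zero hzf''.contDiffAt,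
    iteratedDeriv_id_mul_zero hf''.contDiffAt, iteratedDeriv_id_mul_zero hf'.contDiffAt,
    ← iteratedDeriv_succ'] at hn
  rcases n with _ | _ | n
  · simp only [Nat.cast_zero] at hn ⊢
    linear_combination hn
  · simp only [zero_add, Nat.sub_self, Nat.cast_one, Nat.cast_zero] at hn ⊢
    linear_combination hn
  · simp only [Nat.add_sub_cancel] at hn
    push_cast at hn ⊢
    linear_combination hn

theorem eq_mul_ordinaryHypergeometric_of_hypergeometricOperator_eq_zero {α β γ : ℂ}
    (hγ : ∀ n : ℕ, γ ≠ -(n : ℂ)) {f : ℂ → ℂ} {R : ℝ} (hf : DifferentiableOn ℂ f (ball 0 R))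
    (hode : ∀ z ∈ ball (0 : ℂ) R, hypergeometricOperator α β γ f z = 0) {z : ℂ}
    (hz : z ∈ ball (0 : ℂ) R) (hz₁ : ‖z‖ < 1) : f z = f 0 * ₂F₁ α β γ z := by
  have hR : ball (0 : ℂ) R ∈ 𝓝 0 := ball_mem_nhds 0 (pos_of_mem_ball hz)
  have hrec := iteratedDeriv_succ_of_hypergeometricOperator_eq_zero (hf.analyticAt hR)
    (eventually_of_mem hR hode)
  have hcoeff (n : ℕ) : iteratedDeriv n f 0 = f 0 * (poch(α, n) * poch(β, n) / poch(γ, n)) := by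
    induction n with
    | zero => simp
    | succ n ih =>
      have h₁ : γ + n ≠ 0 := fun h => hγ n (eq_neg_of_add_eq_zero_left h)
      have h₂ := ascPochhammer_eval_ne_zero hγ n
      apply mul_left_cancel₀ h₁
      rw [hrec, ih]
      simp only [ascPochhammer_succ_eval]
      field_simp
  rw [← Complex.taylorSeries_eq_on_ball' hz hf,
    ← (hasSum_ordinaryHypergeometric α β γ hz₁).tsum_eq, ← tsum_mul_left]
  refine tsum_congr fun n => ?_
  rw [hcoeff, sub_zero]
  simp only [div_eq_mul_inv, mul_inv]
  ring

/-! ### Bailey's factorization of `F₄` -/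

theorem hasDerivAt_pow_mul_pow (Y : ℂ) (m n : ℕ) (X : ℂ) :
    HasDerivAt (fun X => (X * (1 - Y)) ^ m * (Y * (1 - X)) ^ n)
      (m * (1 - Y) * ((X * (1 - Y)) ^ (m - 1) * (Y * (1 - X)) ^ n) +
        n * (-Y) * ((X * (1 - Y)) ^ m * (Y * (1 - X)) ^ (n - 1))) X := by
  have hx : HasDerivAt (fun X => X * (1 - Y)) (1 - Y) X := by
    simpa using (hasDerivAt_id X).mul_const (1 - Y)
  have hy : HasDerivAt (fun X => Y * (1 - X)) (-Y) X := by
    simpa using ((hasDerivAt_id X).const_sub 1).const_mul Y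
  convert! (hx.fun_pow m).fun_mul (hy.fun_pow n) using 1
  ring

theorem hypergeometricOperator_pow_mul_pow {α β γ γ' : ℂ} (h : γ + γ' = α + β + 1) (X Y : ℂ)
    (m n : ℕ) :
    hypergeometricOperator α β γ (fun X => (X * (1 - Y)) ^ m * (Y * (1 - X)) ^ n) X =
      (1 - Y) * (m * (m - 1 + γ) * (X * (1 - Y)) ^ (m - 1) * (Y * (1 - X)) ^ n) +
      Y * (n * (n - 1 + γ') * (X * (1 - Y)) ^ m * (Y * (1 - X)) ^ (n - 1)) -
        (α + m + n) * (β + m + n) * (X * (1 - Y)) ^ m * (Y * (1 - X)) ^ n := by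
  have hderiv (m n : ℕ) := funext fun X => (hasDerivAt_pow_mul_pow Y m n X).deriv
  have hderiv₂ := (((hasDerivAt_pow_mul_pow Y (m - 1) n X).const_mul (m * (1 - Y))).fun_add
    ((hasDerivAt_pow_mul_pow Y m (n - 1) X).const_mul (n * (-Y)))).deriv
  obtain rfl : γ' = α + β + 1 - γ := by linear_combination h
  rw [hypergeometricOperator, hderiv, hderiv₂]
  rcases m with _ | _ | m <;> rcases n with _ | _ | n <;>
    simp only [Nat.add_sub_cancel, Nat.cast_zero, Nat.cast_succ, Nat.zero_sub, Nat.sub_self,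
      Nat.zero_add, pow_zero] <;> ring

theorem appellF4Coeff_swap (α β γ γ' : ℂ) (k : ℕ × ℕ) :
    appellF4Coeff α β γ γ' k.swap = appellF4Coeff α β γ' γ k := by
  simp only [appellF4Coeff, Prod.fst_swap, Prod.snd_swap, add_comm k.2 k.1]
  ring

theorem appellF4Coeff_succ_fst (α β : ℂ) {γ : ℂ} (hγ : ∀ n : ℕ, γ ≠ -(n : ℂ)) (γ' : ℂ) (m n : ℕ) :
    (m + 1) * (m + γ) * appellF4Coeff α β γ γ' (m + 1, n) =
      (α + m + n) * (β + m + n) * appellF4Coeff α β γ γ' (m, n) := by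
  have h₁ : γ + m ≠ 0 := fun h => hγ m (eq_neg_of_add_eq_zero_left h)
  have h₂ := ascPochhammer_eval_ne_zero hγ m
  have h₃ : (m.factorial : ℂ) ≠ 0 := by exact_mod_cast m.factorial_ne_zero
  have h₄ : (m + 1 : ℂ) ≠ 0 := by exact_mod_cast m.succ_ne_zero
  simp only [appellF4Coeff, add_right_comm m 1 n, ascPochhammer_succ_eval, Nat.factorial_succ,
    div_eq_mul_inv, mul_inv]
  push_cast
  field_simp
  ring

theorem summable_mul_appellF4 (α β γ γ' : ℂ) {x y : ℂ} (h : √‖x‖ + √‖y‖ < 1) :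
    Summable fun k : ℕ × ℕ => (α + k.1 + k.2) * (β + k.1 + k.2) * appellF4Coeff α β γ γ' k *
      x ^ k.1 * y ^ k.2 := by
  refine ((summable_appellF4 (α + 1) (β + 1) γ γ' h).mul_left (α * β)).congr fun k => ?_
  have hα := ascPochhammer_eval_mul_add α (k.1 + k.2)
  have hβ := ascPochhammer_eval_mul_add β (k.1 + k.2)
  push_cast at hα hβ
  calc _ = (α * poch(α + 1, k.1 + k.2)) * (β * poch(β + 1, k.1 + k.2)) /
        (poch(γ, k.1) * poch(γ', k.2) * (k.1.factorial : ℂ) * (k.2.factorial : ℂ)) *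
          x ^ k.1 * y ^ k.2 := by rw [appellF4Coeff]; ring
    _ = _ := by rw [← hα, ← hβ, appellF4Coeff]; ring

theorem hasSum_appellF4_shift_fst {α β γ : ℂ} (hγ : ∀ n : ℕ, γ ≠ -(n : ℂ)) {γ' x y S : ℂ}
    (h : HasSum (fun k : ℕ × ℕ => (α + k.1 + k.2) * (β + k.1 + k.2) * appellF4Coeff α β γ γ' k *
      x ^ k.1 * y ^ k.2) S) :
    HasSum (fun k : ℕ × ℕ => k.1 * (k.1 - 1 + γ) * appellF4Coeff α β γ γ' k *
      x ^ (k.1 - 1) * y ^ k.2) S := by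
  have hinj : Function.Injective fun k : ℕ × ℕ => (k.1 + 1, k.2) := fun k l hkl => by
    simp only [Prod.mk.injEq] at hkl
    exact Prod.ext (by omega) hkl.2
  refine (hinj.hasSum_iff fun ⟨m, n⟩ hk => ?_).1 (h.congr_fun fun ⟨m, n⟩ => ?_)
  · cases m with
    | zero => simp
    | succ m => exact absurd ⟨(m, n), rfl⟩ hk
  · have hrec := appellF4Coeff_succ_fst α β hγ γ' m n
    simp only [Function.comp_apply, Nat.add_sub_cancel]
    push_cast
    linear_combination x ^ m * y ^ n * hrec

theorem hasSum_appellF4_shift_snd {α β γ γ' : ℂ} (hγ' : ∀ n : ℕ, γ' ≠ -(n : ℂ)) {x y S : ℂ}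
    (h : HasSum (fun k : ℕ × ℕ => (α + k.1 + k.2) * (β + k.1 + k.2) * appellF4Coeff α β γ γ' k *
      x ^ k.1 * y ^ k.2) S) :
    HasSum (fun k : ℕ × ℕ => k.2 * (k.2 - 1 + γ') * appellF4Coeff α β γ γ' k *
      x ^ k.1 * y ^ (k.2 - 1)) S := by
  rw [← (Equiv.prodComm ℕ ℕ).hasSum_iff] at h ⊢
  refine (hasSum_appellF4_shift_fst (α := α) (β := β) (γ' := γ) (x := y) (y := x) hγ'
    (h.congr_fun fun k => ?_)).congr_fun fun k => ?_
  all_goals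
    simp only [Function.comp_apply, Equiv.prodComm_apply, appellF4Coeff_swap, Prod.fst_swap,
      Prod.snd_swap]
    ring

theorem hypergeometricOperator_appellF4 {α β γ γ' : ℂ} (hγ : ∀ n : ℕ, γ ≠ -(n : ℂ))
    (hγ' : ∀ n : ℕ, γ' ≠ -(n : ℂ)) (h : γ + γ' = α + β + 1) {X Y : ℂ}
    (hXY : √‖X * (1 - Y)‖ + √‖Y * (1 - X)‖ < 1) :
    hypergeometricOperator α β γ (fun X => appellF4 α β γ γ' (X * (1 - Y)) (Y * (1 - X))) X =
      0 := by
  have hV : IsOpen {X : ℂ | √‖X * (1 - Y)‖ + √‖Y * (1 - X)‖ < 1} :=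
    isOpen_lt (by fun_prop) (by fun_prop)
  have hsum := hasSum_hypergeometricOperator α β γ
    (hasSumLocallyUniformlyOn_appellF4 α β γ γ' (by fun_prop) (by fun_prop) fun X hX => hX)
    (fun k => by fun_prop) hV hXY
  obtain ⟨S, hS⟩ := summable_mul_appellF4 α β γ γ' hXY
  have hzero := (((hasSum_appellF4_shift_fst hγ hS).mul_left (1 - Y)).add
    ((hasSum_appellF4_shift_snd hγ' hS).mul_left Y)).sub hS
  rw [← add_mul, sub_add_cancel, one_mul, sub_self] at hzero
  refine hsum.unique (hzero.congr_fun fun k => ?_)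
  simp only [mul_assoc (appellF4Coeff α β γ γ' k)]
  rw [hypergeometricOperator_const_mul, hypergeometricOperator_pow_mul_pow h]
  ring

theorem sqrt_norm_mul_add_sqrt_norm_mul_lt_one {X Y : ℂ} {R : ℝ} (hX : ‖X‖ ≤ R)
    (h : √(R * (1 + ‖Y‖)) + √(‖Y‖ * (1 + R)) < 1) :
    √‖X * (1 - Y)‖ + √‖Y * (1 - X)‖ < 1 := by
  have hnorm (Z : ℂ) : ‖1 - Z‖ ≤ 1 + ‖Z‖ := by simpa using norm_sub_le 1 Z
  have hR : 0 ≤ R := (norm_nonneg X).trans hX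
  have hY := hnorm Y
  have hXR : ‖1 - X‖ ≤ 1 + R := (hnorm X).trans (by gcongr)
  refine lt_of_le_of_lt ?_ h
  simp only [norm_mul]
  gcongr

theorem appellF4_factorization_of_lt {α β γ γ' : ℂ} (hγ : ∀ n : ℕ, γ ≠ -(n : ℂ))
    (hγ' : ∀ n : ℕ, γ' ≠ -(n : ℂ)) (h : γ + γ' = α + β + 1) {X Y : ℂ}
    (hXY : √(‖X‖ * (1 + ‖Y‖)) + √(‖Y‖ * (1 + ‖X‖)) < 1) :
    appellF4 α β γ γ' (X * (1 - Y)) (Y * (1 - X)) = ₂F₁ α β γ X * ₂F₁ α β γ' Y := by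
  obtain ⟨R, hR, hlt⟩ : ∃ R > ‖X‖, √(R * (1 + ‖Y‖)) + √(‖Y‖ * (1 + R)) < 1 :=
    exists_gt_of_continuousAt_of_lt (by fun_prop) hXY
  have hball {Z : ℂ} (hZ : Z ∈ ball 0 R) : √‖Z * (1 - Y)‖ + √‖Y * (1 - Z)‖ < 1 :=
    sqrt_norm_mul_add_sqrt_norm_mul_lt_one (mem_ball_zero_iff.1 hZ).le hlt
  have hlt_one {Z W : ℂ} (hZW : √(‖Z‖ * (1 + ‖W‖)) < 1) : ‖Z‖ < 1 := by
    rw [Real.sqrt_lt' one_pos] at hZW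
    nlinarith [mul_nonneg (norm_nonneg Z) (norm_nonneg W)]
  have hX₁ : ‖X‖ < 1 := hlt_one ((le_add_of_nonneg_right (Real.sqrt_nonneg _)).trans_lt hXY)
  have hY₁ : ‖Y‖ < 1 := hlt_one ((le_add_of_nonneg_left (Real.sqrt_nonneg _)).trans_lt hXY)
  have hode := eq_mul_ordinaryHypergeometric_of_hypergeometricOperator_eq_zero hγ
    (differentiableOn_appellF4 α β γ γ' isOpen_ball (by fun_prop) (by fun_prop) fun Z => hball)
    (fun Z hZ => hypergeometricOperator_appellF4 hγ hγ' h (hball hZ)) (mem_ball_zero_iff.2 hR) hX₁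
  rwa [zero_mul, sub_zero, mul_one, appellF4_zero_left α β γ γ' hY₁,
    mul_comm (₂F₁ α β γ' Y)] at hode

/-- The pairs `(X, Y)` at which `F₄` has its arguments `X (1 - Y)` and `Y (1 - X)` in its domain of
absolute convergence and at which the Gauss series in `X` and in `Y` converge. It is not
connected: it also contains `(9/10, 9/10)`, where the factorization fails in general. -/
def appellF4Region : Set (ℂ × ℂ) :=
  {p | √‖p.1 * (1 - p.2)‖ + √‖p.2 * (1 - p.1)‖ < 1 ∧ ‖p.1‖ < 1 ∧ ‖p.2‖ < 1}

theorem isOpen_appellF4Region : IsOpen appellF4Region := by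
  refine (isOpen_lt ?_ ?_).and ((isOpen_lt ?_ ?_).and (isOpen_lt ?_ ?_)) <;> fun_prop

theorem zero_mem_appellF4Region : (0, 0) ∈ appellF4Region := by
  simp [appellF4Region]

theorem eqOn_zero_of_differentiableOn_lines {E F : Type*} [NormedAddCommGroup E] [NormedSpace ℂ E]
    [NormedAddCommGroup F] [NormedSpace ℂ F] [CompleteSpace F] {f : E → F} {U : Set E}
    (hU : IsOpen U) (hUc : IsPreconnected U)
    (hf : ∀ p v : E, DifferentiableOn ℂ (fun w : ℂ => f (p + w • v)) {w | p + w • v ∈ U})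
    {p₀ : E} (hp₀ : p₀ ∈ U) (h₀ : f =ᶠ[𝓝 p₀] 0) : EqOn f 0 U := by
  let _ := NormedSpace.restrictScalars ℝ ℂ E
  suffices hsub : U ⊆ {p | f =ᶠ[𝓝 p] 0} from fun p hp => (hsub hp).eq_of_nhds
  refine hUc.subset_of_closure_inter_subset isOpen_setOfPred_eventually_nhds ⟨p₀, hp₀, h₀⟩ ?_
  rintro p ⟨hp, hpU⟩
  obtain ⟨ε, hε, hball⟩ := Metric.isOpen_iff.1 hU p hpU
  obtain ⟨q, hfq, hq⟩ := Metric.mem_closure_iff.1 hp ε hε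
  rw [dist_comm] at hq
  refine eventually_of_mem (ball_mem_nhds p hε) fun r hr => ?_
  -- Compare `f` with `0` along the complex line through `q` and `r`.
  let V : Set ℂ := {w | q + w • (r - q) ∈ ball p ε}
  have hV : Convex ℝ V := ((convex_ball p ε).translate_preimage_right q).linear_preimage
    ((LinearMap.toSpanSingleton ℂ E (r - q)).restrictScalars ℝ)
  have hline : Continuous fun w : ℂ => q + w • (r - q) := by fun_prop
  have hanalytic : AnalyticOnNhd ℂ (fun w => f (q + w • (r - q))) V :=
    ((hf q (r - q)).mono fun w hw => hball hw).analyticOnNhd (isOpen_ball.preimage hline)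
  have hzero : (fun w : ℂ => f (q + w • (r - q))) =ᶠ[𝓝 0] 0 :=
    (hline.tendsto' 0 q (by simp)).eventually hfq
  have hone := hanalytic.eqOn_zero_of_preconnected_of_eventuallyEq_zero hV.isPreconnected
    (show (0 : ℂ) ∈ V by simpa [V] using hq) hzero (show (1 : ℂ) ∈ V by simpa [V] using hr)
  simpa using hone

theorem appellF4_factorization {α β γ γ' : ℂ} (hγ : ∀ n : ℕ, γ ≠ -(n : ℂ))
    (hγ' : ∀ n : ℕ, γ' ≠ -(n : ℂ)) (h : γ + γ' = α + β + 1) {X Y : ℂ}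
    (hXY : (X, Y) ∈ connectedComponentIn appellF4Region (0, 0)) :
    appellF4 α β γ γ' (X * (1 - Y)) (Y * (1 - X)) = ₂F₁ α β γ X * ₂F₁ α β γ' Y := by
  let f (p : ℂ × ℂ) : ℂ := appellF4 α β γ γ' (p.1 * (1 - p.2)) (p.2 * (1 - p.1)) -
    ₂F₁ α β γ p.1 * ₂F₁ α β γ' p.2
  have hopen : IsOpen (connectedComponentIn appellF4Region (0, 0)) :=
    isOpen_appellF4Region.connectedComponentIn
  have hlines (p v : ℂ × ℂ) : DifferentiableOn ℂ (fun w : ℂ => f (p + w • v))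
      {w | p + w • v ∈ connectedComponentIn appellF4Region (0, 0)} := by
    have hmem {w : ℂ} (hw : p + w • v ∈ connectedComponentIn appellF4Region (0, 0)) :=
      connectedComponentIn_subset _ _ hw
    have h₁ : Differentiable ℂ fun w : ℂ => (p + w • v).1 := by
      simp only [Prod.fst_add, Prod.smul_fst]
      fun_prop
    have h₂ : Differentiable ℂ fun w : ℂ => (p + w • v).2 := by
      simp only [Prod.snd_add, Prod.smul_snd]
      fun_prop
    have hF₄ := differentiableOn_appellF4 α β γ γ' (hopen.preimage (f := fun w : ℂ => p + w • v)
      (by fun_prop)) (h₁.mul (h₂.const_sub 1)).differentiableOn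
      (h₂.mul (h₁.const_sub 1)).differentiableOn fun w hw => (hmem hw).1
    have hX := (differentiableOn_ordinaryHypergeometric α β γ).comp h₁.differentiableOn
      fun w hw => mem_ball_zero_iff.2 (hmem hw).2.1
    have hY := (differentiableOn_ordinaryHypergeometric α β γ').comp h₂.differentiableOn
      fun w hw => mem_ball_zero_iff.2 (hmem hw).2.2
    exact hF₄.sub (hX.mul hY)
  have hzero : f =ᶠ[𝓝 (0, 0)] 0 := by
    have hcont : Continuous fun p : ℂ × ℂ =>
      √(‖p.1‖ * (1 + ‖p.2‖)) + √(‖p.2‖ * (1 + ‖p.1‖)) := by fun_prop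
    filter_upwards [hcont.continuousAt.eventually_lt_const (u := 1) (by simp)] with p hp
    exact sub_eq_zero.2 (appellF4_factorization_of_lt hγ hγ' h hp)
  have hmem := mem_connectedComponentIn zero_mem_appellF4Region
  have hf := eqOn_zero_of_differentiableOn_lines hopen isPreconnected_connectedComponentIn hlines
    hmem hzero
  have hfXY : f (X, Y) = 0 := hf hXY
  simpa only [f, sub_eq_zero] using hfXY

/-! ### Reduction of `H₄` to `F₄` -/

theorem hasSum_hornH4Term_snd (a b c d x : ℂ) {y : ℂ} (hy : ‖y‖ < 1) (m : ℕ) :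
    HasSum (fun n => hornH4Term a b c d x y (m, n))
      (poch(a, 2 * m) / (poch(c, m) * (m.factorial : ℂ)) * x ^ m *
        ₂F₁ (a + (2 * m : ℕ)) b d y) := by
  refine ((hasSum_ordinaryHypergeometric _ b d hy).mul_left _).congr_fun fun n => ?_
  simp only [hornH4Term, ascPochhammer_eval_add, div_eq_mul_inv, mul_inv]
  ring

theorem hasSum_appellF4_snd (α β γ γ' x : ℂ) {y : ℂ} (hy : ‖y‖ < 1) (m : ℕ) :
    HasSum (fun n => appellF4Coeff α β γ γ' (m, n) * x ^ m * y ^ n)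
      (poch(α, m) * poch(β, m) / (poch(γ, m) * (m.factorial : ℂ)) * x ^ m *
        ₂F₁ (α + m) (β + m) γ' y) := by
  refine ((hasSum_ordinaryHypergeometric _ _ γ' hy).mul_left _).congr_fun fun n => ?_
  simp only [appellF4Coeff, ascPochhammer_eval_add, div_eq_mul_inv, mul_inv]
  ring

theorem hornH4_eq_appellF4 (a c : ℂ) {b : ℂ} (hb : ∀ n : ℕ, 2 * b ≠ -(n : ℂ)) {u z : ℂ}
    (h : √‖u‖ + 2 * ‖z‖ < ‖1 - z‖) :
    hornH4 a b c (2 * b) (u / (4 * (1 - z) ^ 2)) (2 * z / (z - 1)) =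
      (1 - z) ^ a * appellF4 (a / 2 + 1 / 2) (a / 2) c (b + 1 / 2) u (z ^ 2) := by
  have hz : 2 * ‖z‖ < ‖1 - z‖ := (le_add_of_nonneg_left (Real.sqrt_nonneg _)).trans_lt h
  have hz₀ : 1 - z ≠ 0 := norm_pos_iff.1 ((by positivity : 0 ≤ 2 * ‖z‖).trans_lt hz)
  have hw : ‖2 * z / (z - 1)‖ < 1 := by
    rwa [norm_div, norm_mul, Complex.norm_ofNat, norm_sub_rev, div_lt_one (norm_pos_iff.2 hz₀)]
  have hlt : √‖u‖ + √‖z ^ 2‖ < 1 := by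
    have hnorm := norm_sub_le 1 z
    rw [norm_one] at hnorm
    rw [norm_pow, Real.sqrt_sq (norm_nonneg z)]
    linarith
  have hz₂ : ‖z ^ 2‖ < 1 := by
    rw [norm_pow]
    exact pow_lt_one₀ (norm_nonneg z) (norm_lt_one_of_two_mul_norm_lt hz) two_ne_zero
  rw [hornH4, appellF4, (summable_appellF4 _ _ _ _ hlt).tsum_prod, ← tsum_mul_left]
  refine tsum_congr fun m => ?_
  rw [(hasSum_hornH4Term_snd _ _ _ _ _ hw m).tsum_eq, (hasSum_appellF4_snd _ _ _ _ _ hz₂ m).tsum_eq,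
    ordinaryHypergeometric_quadratic _ hb hz, ascPochhammer_eval_two_mul,
    Complex.cpow_add _ _ hz₀, Complex.cpow_natCast]
  have hhalf : (a + (2 * m : ℕ)) / 2 = a / 2 + m := by push_cast; ring
  have hpow : (u / (4 * (1 - z) ^ 2)) ^ m * (1 - z) ^ (2 * m) * 4 ^ m = u ^ m := by
    rw [pow_mul, ← mul_pow, ← mul_pow]
    congr 1
    field_simp
  rw [hhalf, add_right_comm (a / 2) (m : ℂ), ← hpow]
  ring

/-! ### Bailey's parametrization -/

theorem isOpen_baileyRegion : IsOpen baileyRegion := by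
  refine isOpen_iff_mem_nhds.2 fun p hp => ?_
  have hne : p.1 * p.2 - 1 ≠ 0 := sub_ne_zero.2 hp.1
  have hX : ContinuousAt (fun p : ℂ × ℂ => baileyX p.1 p.2) p := by
    unfold baileyX
    fun_prop (disch := simpa)
  have hY : ContinuousAt (fun p : ℂ × ℂ => baileyY p.1 p.2) p := by
    unfold baileyY
    fun_prop (disch := simpa)
  have hst : ContinuousAt (fun p : ℂ × ℂ => p.1 * p.2) p := by fun_prop
  have hXY : ContinuousAt (fun p : ℂ × ℂ => 2 * √‖baileyX p.1 p.2‖ + ‖baileyY p.1 p.2‖) p := by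
    fun_prop
  have hs : ContinuousAt (fun p : ℂ × ℂ => ‖1 - p.1 ^ 2‖) p := by fun_prop
  have ht : ContinuousAt (fun p : ℂ × ℂ => ‖p.2 ^ 2‖) p := by fun_prop
  exact (hst.eventually_ne hp.1).and ((hXY.eventually_lt_const hp.2.1).and
    ((hs.eventually_lt_const hp.2.2.1).and (ht.eventually_lt_const hp.2.2.2)))

theorem one_zero_mem_baileyRegion : (1, 0) ∈ baileyRegion := by
  simp [baileyRegion, baileyX, baileyY]

theorem baileyX_eq (s t : ℂ) :
    baileyX s t = (1 - s ^ 2) * (1 - t ^ 2) / (4 * (1 - s * t) ^ 2) := by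
  rw [baileyX]
  congr 1 <;> ring

theorem baileyY_eq (s t : ℂ) : baileyY s t = 2 * (s * t) / (s * t - 1) := by
  rw [baileyY, mul_assoc]

theorem sqrt_norm_add_two_mul_norm_lt_of_mem_baileyRegion {s t : ℂ} (h : (s, t) ∈ baileyRegion) :
    √‖(1 - s ^ 2) * (1 - t ^ 2)‖ + 2 * ‖s * t‖ < ‖1 - s * t‖ := by
  obtain ⟨hst, hlt, -, -⟩ := h
  have hpos : 0 < ‖1 - s * t‖ := norm_pos_iff.2 (sub_ne_zero.2 (Ne.symm hst))
  have hX : 2 * √‖baileyX s t‖ = √‖(1 - s ^ 2) * (1 - t ^ 2)‖ / ‖1 - s * t‖ := by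
    have hden : ‖4 * (1 - s * t) ^ 2‖ = (2 * ‖1 - s * t‖) ^ 2 := by
      rw [norm_mul, norm_pow, Complex.norm_ofNat]
      ring
    rw [baileyX_eq, norm_div, hden, Real.sqrt_div' _ (sq_nonneg _), Real.sqrt_sq (by positivity)]
    ring
  have hY : ‖baileyY s t‖ = 2 * ‖s * t‖ / ‖1 - s * t‖ := by
    rw [baileyY_eq, norm_div, norm_mul, Complex.norm_ofNat, norm_sub_rev]
  rwa [hX, hY, ← add_div, div_lt_one hpos] at hlt

theorem one_sub_sq_sq_mem_appellF4Region {s t : ℂ} (h : (s, t) ∈ baileyRegion) :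
    (1 - s ^ 2, t ^ 2) ∈ appellF4Region := by
  refine ⟨?_, h.2.2⟩
  have hlt := sqrt_norm_add_two_mul_norm_lt_of_mem_baileyRegion h
  have hnorm := norm_sub_le 1 (s * t)
  rw [norm_one] at hnorm
  have hsq : t ^ 2 * (1 - (1 - s ^ 2)) = (s * t) ^ 2 := by ring
  simp only [hsq, norm_pow, Real.sqrt_sq (norm_nonneg _)]
  linarith

theorem one_sub_sq_sq_mem_connectedComponentIn {s t : ℂ} (h : (s, t) ∈ baileyDomain) :
    (1 - s ^ 2, t ^ 2) ∈ connectedComponentIn appellF4Region (0, 0) := by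
  let g (p : ℂ × ℂ) : ℂ × ℂ := (1 - p.1 ^ 2, p.2 ^ 2)
  have hg : g '' baileyDomain ⊆ appellF4Region := by
    rintro _ ⟨p, hp, rfl⟩
    exact one_sub_sq_sq_mem_appellF4Region (connectedComponentIn_subset _ _ hp)
  have hconn : IsPreconnected (g '' baileyDomain) :=
    isPreconnected_connectedComponentIn.image g (by fun_prop)
  have hzero : (0, 0) ∈ g '' baileyDomain :=
    ⟨(1, 0), mem_connectedComponentIn one_zero_mem_baileyRegion, by simp [g]⟩
  exact hconn.subset_connectedComponentIn hzero hg ⟨(s, t), h, rfl⟩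

theorem hornH4_bailey_eq_appellF4 (a c : ℂ) {b : ℂ} (hb : ∀ n : ℕ, 2 * b ≠ -(n : ℂ)) {s t : ℂ}
    (h : (s, t) ∈ baileyRegion) :
    hornH4 a b c (2 * b) (baileyX s t) (baileyY s t) =
      (1 - s * t) ^ a * appellF4 (a / 2 + 1 / 2) (a / 2) c (b + 1 / 2)
        ((1 - s ^ 2) * (1 - t ^ 2)) (t ^ 2 * (1 - (1 - s ^ 2))) := by
  rw [baileyX_eq, baileyY_eq,
    hornH4_eq_appellF4 a c hb (sqrt_norm_add_two_mul_norm_lt_of_mem_baileyRegion h)]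
  ring_nf

theorem mainTheorem1 (q₀ q₁ : ℂ)
    (hc : ∀ n : ℕ, 1 + q₀ - q₁ ≠ -(n : ℂ)) (hd : ∀ n : ℕ, 2 * q₁ ≠ -(n : ℂ)) :
    IsOpen baileyDomain ∧ ((1, 0) : ℂ × ℂ) ∈ baileyDomain ∧
      ∀ s t : ℂ, (s, t) ∈ baileyDomain →
        Summable (hornH4Term q₀ q₁ (1 + q₀ - q₁) (2 * q₁) (baileyX s t) (baileyY s t)) ∧
        hornH4 q₀ q₁ (1 + q₀ - q₁) (2 * q₁) (baileyX s t) (baileyY s t) =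
          (1 - s * t) ^ q₀ *
            ordinaryHypergeometric (q₀ / 2 + 1 / 2) (q₀ / 2) (q₀ - q₁ + 1) (1 - s ^ 2) *
            ordinaryHypergeometric (q₀ / 2 + 1 / 2) (q₀ / 2) (q₁ + 1 / 2) (t ^ 2) := by
  refine ⟨isOpen_baileyRegion.connectedComponentIn,
    mem_connectedComponentIn one_zero_mem_baileyRegion, fun s t hst => ?_⟩
  have hmem : (s, t) ∈ baileyRegion := connectedComponentIn_subset _ _ hst
  have hγ : q₀ - q₁ + 1 = 1 + q₀ - q₁ := by ring
  refine ⟨summable_hornH4Term _ _ _ _ hmem.2.1, ?_⟩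
  rw [hornH4_bailey_eq_appellF4 q₀ _ hd hmem, appellF4_factorization hc (add_half_ne_neg_natCast hd)
    (by ring) (one_sub_sq_sq_mem_connectedComponentIn hst), hγ, mul_assoc]
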